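/- Let $\omega=\{0,1,2,\dots\}$, let $[A]^\omega$ be the family of infinite subsets of $A\subseteq\omega$, and let $[A]^2$ be the set of unordered pairs of distinct elements of $A$. For $\rho:\mathcal F\to\mathcal P(\Lambda)$ with $\mathcal F\subseteq\mathcal P(\Omega)$, where $\mathcal F$ is closed under removing finite sets, put $$\mathcal I_\rho=\{A\subseteq\Lambda:\ \forall F\in\mathcal F\ \ \rho(F)\not\subseteq A\}.$$ For infinite sets $D,H,E\subseteq\omega$ let $$FS(D)=\Big\{\sum_{n\in\alpha}n:\ \emptyset\ne\alpha\subseteq D\text{ finite}\Big\},\qquad r(H)=[H]^2\subseteq[\omega]^2,\qquad \Delta(E)=\{a-b:\ a,b\in E,\ a>b\},$$ and let $\mathcal H=\mathcal I_{FS}$ (on $\omega$), $\mathcal R=\mathcal I_r$ (on $[\omega]^2$), $\mathcal D=\mathcal I_\Delta$ (on $\omega$). Let $\mathcal I_{1/n}=\{A\subseteq\omega:\sum_{n\in A}\frac1{n+1}<\infty\}$, and let $\mathcal W$ be the family of those $A\subseteq\omega$ that do not contain arithmetic progressions of arbitrary finite length (with positive common difference). For an ideal $\mathcal I$ on $\Lambda$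 let $\rho_{\mathcal I}$ be the function defined on $\mathcal I^+=\mathcal P(\Lambda)\setminus\mathcal I$ by $\rho_{\mathcal I}(A)=A$. For ideals $\mathcal I_i$ on $\Lambda_i$, write $\mathcal I_2\le_K\mathcal I_1$ if there is $\phi:\Lambda_1\to\Lambda_2$ with $\phi[A]\notin\mathcal I_2$ for every $A\notin\mathcal I_1$. For functions $\rho_i:\mathcal F_i\to\mathcal P(\Lambda_i)$ as above, with $\mathcal F_i\subseteq\mathcal P(\Omega_i)$, write $\rho_2\le_K\rho_1$ if there is $\phi:\Lambda_1\to\Lambda_2$ such that for every $F_1\in\mathcal F_1$ there is $F_2\in\mathcal F_2$ such that for every finite $K_1\subseteq\Omega_1$ there is a finite $K_2\subseteq\Omega_2$ with $\rho_2(F_2\setminus K_2)\subseteq\phi[\rho_1(F_1\setminus K_1)]$. Then: 1. $\mathcal H\not\le_K\mathcal R$ and $FS\not\le_K r$. 2. $\mathcal R\not\le_K\mathcal H$ and $r\not\le_K FS$. 3. $\Delta\le_K FS$, $\mathcal D\subseteq\mathcal H$ and $\mathcal D\le_K\mathcal H$. 4. $\Delta\le_K r$ and $\mathcal D\le_K\mathcal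 R$. 5. $\mathcal R\not\le_K\mathcal D$ and $r\not\le_K\Delta$. 6. $\mathcal H\not\le_K\mathcal D$ and $FS\not\le_K\Delta$. 7. $\mathcal I_{1/n}\not\le_K\mathcal R$ and $\rho_{\mathcal I_{1/n}}\not\le_K r$. 8. $\mathcal I_{1/n}\not\le_K\mathcal H$ and $\rho_{\mathcal I_{1/n}}\not\le_K FS$. 9. $\mathcal I_{1/n}\not\le_K\mathcal D$ and $\rho_{\mathcal I_{1/n}}\not\le_K\Delta$. 10. $\mathcal I_{1/n}\not\le_K\mathcal W$ and $\rho_{\mathcal I_{1/n}}\not\le_K\rho_{\mathcal W}$. 11. $\mathcal D\not\le_K\mathcal I_{1/n}$ and $\Delta\not\le_K\rho_{\mathcal I_{1/n}}$. 12. $\mathcal H\not\le_K\mathcal I_{1/n}$ and $FS\not\le_K\rho_{\mathcal I_{1/n}}$. 13. $\mathcal R\not\le_K\mathcal I_{1/n}$ and $r\not\le_K\rho_{\mathcal I_{1/n}}$. 14. $\mathcal D\not\le_K\mathcal W$ and $\Delta\not\le_K\rho_{\mathcal W}$. 15. $\mathcal H\not\le_K\mathcal W$ and $FS\not\le_K\rho_{\mathcal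 W}$. 16. $\mathcal R\not\le_K\mathcal W$ and $r\not\le_K\rho_{\mathcal W}$. -/

import Mathlib

namespace Katetov

/-- The data of a function `ρ : 𝓕 → 𝒫(Λ)` with `𝓕 ⊆ 𝒫(Ω)`. Only the values `ρ.map F` with
`F ∈ ρ.dom` matter. Partition regular functions are considered as such data. -/
structure SetOp (Ω Λ : Type*) where
  /-- the family `𝓕` on which `ρ` is defined -/
  dom : Set (Set Ω)
  /-- the values of `ρ` -/
  map : Set Ω → Set Λ

/-- The family `I_ρ` of the sets `A ⊆ Λ` that contain no `ρ(F)` with `F ∈ 𝓕`. -/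
def SetOp.ideal {Ω Λ : Type*} (ρ : SetOp Ω Λ) : Set (Set Λ) :=
  {A | ∀ F ∈ ρ.dom, ¬ ρ.map F ⊆ A}

/-- The function `ρ_I : I⁺ → 𝒫(Λ)`, `ρ_I(A) = A`. -/
def SetOp.ofIdeal {Λ : Type*} (I : Set (Set Λ)) : SetOp Λ Λ where
  dom := {A | A ∉ I}
  map A := A

/-- The Katětov order between ideals: `IdealLE I₂ I₁` is `I₂ ≤_K I₁`. -/
def IdealLE {Λ₂ Λ₁ : Type*} (I₂ : Set (Set Λ₂)) (I₁ : Set (Set Λ₁)) : Prop :=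
  ∃ φ : Λ₁ → Λ₂, ∀ A : Set Λ₁, A ∉ I₁ → φ '' A ∉ I₂

/-- The Katětov order between partition regular functions: `SetOp.LE ρ₂ ρ₁` is `ρ₂ ≤_K ρ₁`. -/
def SetOp.LE {Ω₂ Λ₂ Ω₁ Λ₁ : Type*} (ρ₂ : SetOp Ω₂ Λ₂) (ρ₁ : SetOp Ω₁ Λ₁) : Prop :=
  ∃ φ : Λ₁ → Λ₂, ∀ F₁ ∈ ρ₁.dom, ∃ F₂ ∈ ρ₂.dom, ∀ K₁ : Set Ω₁, K₁.Finite →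
    ∃ K₂ : Set Ω₂, K₂.Finite ∧ ρ₂.map (F₂ \ K₂) ⊆ φ '' ρ₁.map (F₁ \ K₁)

/-- `[ω]²`, the unordered pairs of distinct natural numbers. -/
abbrev Pairs : Type := {s : Finset ℕ // s.card = 2}

/-- `FS(D)`: the sums of finite nonempty sets of (distinct) elements of `D`. -/
def FS : SetOp ℕ ℕ where
  dom := {D | D.Infinite}
  map D := {n | ∃ α : Finset ℕ, α.Nonempty ∧ (α : Set ℕ) ⊆ D ∧ n = ∑ i ∈ α, i}

/-- `r(H) = [H]²`. -/
def r : SetOp ℕ Pairs where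
  dom := {H | H.Infinite}
  map H := {p | (p.1 : Set ℕ) ⊆ H}

/-- `Δ(E)`: the positive differences of elements of `E`. -/
def Δ : SetOp ℕ ℕ where
  dom := {E | E.Infinite}
  map E := {d | ∃ a ∈ E, ∃ b ∈ E, b < a ∧ d = a - b}

/-- The Hindman ideal `I_FS`. -/
def hindman : Set (Set ℕ) := FS.ideal

/-- The Ramsey ideal `I_r`. -/
def ramsey : Set (Set Pairs) := r.ideal

/-- The ideal `𝒟 = I_Δ`. -/
def diff : Set (Set ℕ) := Δ.ideal

/-- The summable ideal `I_{1/n}`. -/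
def summable : Set (Set ℕ) := {A | Summable fun n : A => 1 / (((n : ℕ) : ℝ) + 1)}

/-- AP-sets: sets containing arithmetic progressions of arbitrary finite length. -/
def IsAPSet (A : Set ℕ) : Prop :=
  ∀ k : ℕ, ∃ a d : ℕ, 0 < d ∧ ∀ i < k, a + i * d ∈ A

/-- The van der Waerden ideal. -/
def vdW : Set (Set ℕ) := {A | ¬ IsAPSet A}

end Katetov

namespace Katetov

open Filter

/-! ### The two Katětov orders -/

/-! A reduction between functions yields one between their ideals, so each negative claim need only
be refuted for ideals: given `φ`, exhibit a positive set whose image is small. Since `delta_le_FS`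
and `delta_le_r` put `diff` below `hindman` and `ramsey`, transitivity leaves seven cases. For `vdW`
and `summable` as source, positive sets are unions of finite pieces that survive finite colourings;
`exists_sparse_image` picks pieces whose images are bounded, or are far apart and congruent modulo
large numbers. For `ramsey` as source, `φ` is a function of two variables, classified by its
iterated limits along a nonprincipal ultrafilter; an infinite set is then built by recursion. For
`hindman` as source, an idempotent ultrafilter plays this role (`IsFreeIdempotent.trichotomy`), and
`exists_strictMono_sums` is the Galvin–Glazer recursion with side conditions on all earlier sums. -/

theorem IdealLE.trans {Λ₁ Λ₂ Λ₃ : Type*} {I₁ : Set (Set Λ₁)} {I₂ : Set (Set Λ₂)}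
    {I₃ : Set (Set Λ₃)} (h₃₂ : IdealLE I₃ I₂) (h₂₁ : IdealLE I₂ I₁) : IdealLE I₃ I₁ := by
  obtain ⟨φ, hφ⟩ := h₃₂
  obtain ⟨ψ, hψ⟩ := h₂₁
  exact ⟨φ ∘ ψ, fun A hA => by rw [Set.image_comp]; exact hφ _ (hψ A hA)⟩

theorem SetOp.LE.idealLE {Ω₂ Λ₂ Ω₁ Λ₁ : Type*} {ρ₂ : SetOp Ω₂ Λ₂} {ρ₁ : SetOp Ω₁ Λ₁}
    (hdom : ∀ F ∈ ρ₂.dom, ∀ K : Set Ω₂, K.Finite → F \ K ∈ ρ₂.dom) (h : SetOp.LE ρ₂ ρ₁) :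
    IdealLE ρ₂.ideal ρ₁.ideal := by
  obtain ⟨φ, hφ⟩ := h
  refine ⟨φ, fun A hA hI => ?_⟩
  simp only [SetOp.ideal, Set.mem_ofPred_eq, not_forall, not_not] at hA
  obtain ⟨F₁, hF₁, hA⟩ := hA
  obtain ⟨F₂, hF₂, h⟩ := hφ F₁ hF₁
  obtain ⟨K₂, hK₂, hsub⟩ := h ∅ Set.finite_empty
  refine hI _ (hdom F₂ hF₂ K₂ hK₂) (hsub.trans (Set.image_mono ?_))
  simpa using hA

theorem ideal_ofIdeal {Λ : Type*} {I : Set (Set Λ)} (hI : ∀ A B : Set Λ, A ⊆ B → B ∈ I → A ∈ I) :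
    (SetOp.ofIdeal I).ideal = I := by
  ext A
  refine ⟨fun h => by_contra fun hA => h A hA subset_rfl, fun hA F hF hFA => hF (hI F A hFA hA)⟩

theorem not_idealLE_of_forall {Ω Λ₂ Λ₁ : Type*} {I : Set (Set Λ₂)} {ρ : SetOp Ω Λ₁}
    (h : ∀ φ : Λ₁ → Λ₂, ∃ F ∈ ρ.dom, φ '' ρ.map F ∈ I) : ¬ IdealLE I ρ.ideal := by
  rintro ⟨φ, hφ⟩
  obtain ⟨F, hF, hI⟩ := h φ
  exact hφ (ρ.map F) (fun h => h F hF subset_rfl) hI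

/-! ### The summable ideal and the van der Waerden ideal -/

theorem mem_summable_iff {A : Set ℕ} :
    A ∈ summable ↔ Summable (A.indicator fun n : ℕ => 1 / ((n : ℝ) + 1)) :=
  summable_subtype_iff_indicator (f := fun n : ℕ => 1 / ((n : ℝ) + 1))

theorem summable_mono {A B : Set ℕ} (h : A ⊆ B) (hB : B ∈ summable) : A ∈ summable := by
  rw [mem_summable_iff] at *
  have := hB.indicator A
  rwa [Set.indicator_indicator, Set.inter_eq_left.2 h] at this

theorem summable_of_finite {A : Set ℕ} (h : A.Finite) : A ∈ summable := by
  rw [mem_summable_iff]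
  exact summable_of_hasFiniteSupport (h.subset Set.support_indicator_subset)

theorem summable_union {A B : Set ℕ} (hA : A ∈ summable) (hB : B ∈ summable) :
    A ∪ B ∈ summable := by
  rw [← Set.union_sdiff_self]
  have hB' := summable_mono (Set.sdiff_subset (s := B) (t := A)) hB
  rw [mem_summable_iff] at *
  rw [Set.indicator_union_of_disjoint Set.disjoint_sdiff_right]
  exact hA.add hB'

theorem not_summable_diff {A K : Set ℕ} (hA : A ∉ summable) (hK : K.Finite) :
    A \ K ∉ summable := fun h =>
  hA (summable_mono (by simp) (summable_union h (summable_of_finite hK)))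

theorem univ_notMem_summable : Set.univ ∉ summable := by
  rw [mem_summable_iff, Set.indicator_univ]
  intro h
  refine Real.not_summable_one_div_natCast ((summable_nat_add_iff 1).1 ?_)
  simpa using h

/-- Level `n` contributes at most `2 * 2 ^ n / 4 ^ n`, a geometric series with sum 4. -/
theorem summable_of_subset_iUnion {B : Set ℕ} (S : ℕ → Finset ℕ) (hB : ∀ x ∈ B, ∃ n, x ∈ S n)
    (hcard : ∀ n, (S n).card ≤ 2 * 2 ^ n) (hle : ∀ n, ∀ x ∈ S n, 4 ^ n ≤ x) : B ∈ summable := by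
  classical
  choose g hg using fun x : B => hB x x.2
  refine summable_of_sum_le (c := 4) (fun x => by positivity) fun u => ?_
  rw [← Finset.sum_fiberwise_of_maps_to (t := u.image g) (g := g)
    (fun x hx => Finset.mem_image_of_mem g hx)]
  have key : ∀ n, ∑ x ∈ u with g x = n, 1 / (((x : ℕ) : ℝ) + 1) ≤ 2 * (1 / 2 : ℝ) ^ n := by
    intro n
    have h1 : ∀ x ∈ u.filter (fun x => g x = n), 1 / (((x : ℕ) : ℝ) + 1) ≤ 1 / 4 ^ n := by
      intro x hx
      have h4 : 4 ^ n ≤ (x : ℕ) := hle n x ((Finset.mem_filter.1 hx).2 ▸ hg x)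
      have h4' : (4 : ℝ) ^ n ≤ ((x : ℕ) : ℝ) := by exact_mod_cast h4
      gcongr
      linarith
    have h2 : (u.filter (fun x => g x = n)).card ≤ (S n).card := by
      rw [← Finset.card_map (Function.Embedding.subtype _)]
      refine Finset.card_le_card fun y hy => ?_
      obtain ⟨x, hx, rfl⟩ := Finset.mem_map.1 hy
      exact (Finset.mem_filter.1 hx).2 ▸ hg x
    have h3 : ((u.filter (fun x => g x = n)).card : ℝ) ≤ 2 * 2 ^ n := by
      exact_mod_cast h2.trans (hcard n)
    refine (Finset.sum_le_card_nsmul _ _ _ h1).trans ?_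
    rw [nsmul_eq_mul]
    calc _ ≤ (2 * 2 ^ n : ℝ) * (1 / 4 ^ n) := by gcongr
      _ = 2 * (1 / 2 : ℝ) ^ n := by
        rw [show (4 : ℝ) = 2 * 2 by norm_num, mul_pow, div_pow]
        field_simp
        simp
  calc _ ≤ ∑ n ∈ u.image g, 2 * (1 / 2 : ℝ) ^ n := Finset.sum_le_sum fun n _ => key n
    _ ≤ ∑' n : ℕ, 2 * (1 / 2 : ℝ) ^ n :=
      (summable_geometric_two.mul_left 2).sum_le_tsum _ (fun n _ => by positivity)
    _ = 4 := by rw [tsum_mul_left, tsum_geometric_two]; norm_num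

theorem vdW_mono {A B : Set ℕ} (h : A ⊆ B) (hB : B ∈ vdW) : A ∈ vdW := fun hA =>
  hB fun k => (hA k).imp fun _ => Exists.imp fun _ H => ⟨H.1, fun i hi => h (H.2 i hi)⟩

/-! ### Criteria for membership in the ideals -/

/-- If `b < a` are fixed in `E`, every larger `e ∈ E` gives two differences `e - a` and `e - b` at
the constant distance `a - b`. -/
theorem diff_of_finite_gaps {B : Set ℕ} (h : ∀ d, 0 < d → {y | y ∈ B ∧ y + d ∈ B}.Finite) :
    B ∈ diff := by
  intro E hE hsub
  have hE' : E.Infinite := hE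
  obtain ⟨b, hb⟩ := hE'.nonempty
  obtain ⟨a, ha, hba⟩ := hE'.exists_gt b
  have hinf := (hE'.sdiff (Set.finite_Iic a)).image
    (f := fun e => e - a) (fun x hx y hy hxy => by
      have h1 := hx.2; have h2 := hy.2
      simp only [Set.mem_Iic, not_le] at h1 h2 hxy; omega)
  refine hinf ((h (a - b) (by omega)).subset ?_)
  rintro _ ⟨e, ⟨he, hea⟩, rfl⟩
  simp only [Set.mem_Iic, not_le] at hea
  exact ⟨hsub ⟨e, he, a, ha, hea, rfl⟩, hsub ⟨e, he, b, hb, by omega, by dsimp only; omega⟩⟩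

theorem diff_of_finite {B : Set ℕ} (h : B.Finite) : B ∈ diff :=
  diff_of_finite_gaps fun _ _ => h.subset fun _ hy => hy.1

/-- Two fixed generators `a < b` and any larger generator `y` produce the whole pattern `y, y + a, y
+ b, y + a + b` of finite sums. -/
theorem hindman_of_finite_squares {B : Set ℕ}
    (h : ∀ a b, 0 < a → a < b → {y | y ∈ B ∧ y + a ∈ B ∧ y + b ∈ B ∧ y + a + b ∈ B}.Finite) :
    B ∈ hindman := by
  intro D hD hsub
  have hD' : D.Infinite := hD
  obtain ⟨a, ha, ha0⟩ := hD'.exists_gt 0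
  obtain ⟨b, hb, hab⟩ := hD'.exists_gt a
  refine (hD'.sdiff (Set.finite_Iic b)) ((h a b ha0 hab).subset ?_)
  rintro y ⟨hy, hyb⟩
  simp only [Set.mem_Iic, not_le] at hyb
  refine ⟨hsub ⟨{y}, by simp, by simpa, by simp⟩, hsub ⟨{y, a}, by simp, ?_, ?_⟩,
    hsub ⟨{y, b}, by simp, ?_, ?_⟩, hsub ⟨{y, a, b}, by simp, ?_, ?_⟩⟩
  · simp [Set.insert_subset_iff, *]
  · rw [Finset.sum_pair (by omega)]
  · simp [Set.insert_subset_iff, *]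
  · rw [Finset.sum_pair (by omega)]
  · simp [Set.insert_subset_iff, *]
  · rw [Finset.sum_insert (by simp; omega), Finset.sum_pair (by omega), add_assoc]

theorem exists_pair_coordinates {X : Type*} (φ : X → Pairs) :
    ∃ a b : X → ℕ, (∀ x, a x < b x) ∧ ∀ x, (φ x).1 = {a x, b x} := by
  have : ∀ x, ∃ p : ℕ × ℕ, p.1 < p.2 ∧ (φ x).1 = {p.1, p.2} := fun x => by
    obtain ⟨u, v, huv, h⟩ := Finset.card_eq_two.1 (φ x).2
    rcases lt_or_gt_of_ne huv with hlt | hlt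
    · exact ⟨(u, v), hlt, h⟩
    · exact ⟨(v, u), hlt, by rw [h, Finset.pair_comm]⟩
  choose p hp using this
  exact ⟨fun x => (p x).1, fun x => (p x).2, fun x => (hp x).1, fun x => (hp x).2⟩

theorem exists_coordinates_eq {X : Type*} {φ : X → Pairs} {a b : X → ℕ} {S : Set X}
    (hab : ∀ x, a x < b x) (hφ : ∀ x, (φ x).1 = {a x, b x}) {H : Set ℕ}
    (hsub : r.map H ⊆ φ '' S) {i j : ℕ} (hi : i ∈ H) (hj : j ∈ H) (hij : i < j) :
    ∃ x ∈ S, a x = i ∧ b x = j := by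
  obtain ⟨x, hx, hxp⟩ := hsub (show (⟨{i, j}, Finset.card_pair hij.ne⟩ : Pairs) ∈ r.map H by
    simp [r, Set.insert_subset_iff, hi, hj])
  refine ⟨x, hx, ?_⟩
  have h : ({a x, b x} : Finset ℕ) = {i, j} := by rw [← hφ x, hxp]
  have := hab x
  have h1 : a x ∈ ({i, j} : Finset ℕ) := h ▸ by simp
  have h2 : b x ∈ ({i, j} : Finset ℕ) := h ▸ by simp
  simp only [Finset.mem_insert, Finset.mem_singleton] at h1 h2
  omega

/-- For `i < j < k` in a homogeneous set, `j` is the upper point of one pair and the lower point of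
another. -/
theorem ramsey_of_disjoint {X : Type*} {φ : X → Pairs} {a b : X → ℕ} {S : Set X}
    (hab : ∀ x, a x < b x) (hφ : ∀ x, (φ x).1 = {a x, b x})
    (h : ∀ x ∈ S, ∀ y ∈ S, a x ≠ b y) : φ '' S ∈ ramsey := by
  intro H hH hsub
  have hH' : H.Infinite := hH
  obtain ⟨i, hi⟩ := hH'.nonempty
  obtain ⟨j, hj, hij⟩ := hH'.exists_gt i
  obtain ⟨k, hk, hjk⟩ := hH'.exists_gt j
  obtain ⟨y, hy, -, hby⟩ := exists_coordinates_eq hab hφ hsub hi hj hij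
  obtain ⟨x, hx, hax, -⟩ := exists_coordinates_eq hab hφ hsub hj hk hjk
  exact h x hx y hy (hax.trans hby.symm)

/-- In an infinite homogeneous set the least chosen point is the lower coordinate of pairs with
infinitely many upper coordinates. -/
theorem ramsey_of_finite {X : Type*} {φ : X → Pairs} {a b : X → ℕ} {S : Set X}
    (hab : ∀ x, a x < b x) (hφ : ∀ x, (φ x).1 = {a x, b x})
    (h : ∀ c, (b '' {x | x ∈ S ∧ a x = c}).Finite) : φ '' S ∈ ramsey := by
  intro H hH hsub
  have hH' : H.Infinite := hH
  obtain ⟨i, hi⟩ := hH'.nonempty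
  refine hH'.sdiff (Set.finite_Iic i) ((h i).subset ?_)
  rintro j ⟨hj, hij⟩
  simp only [Set.mem_Iic, not_le] at hij
  obtain ⟨x, hx, hax, hbx⟩ := exists_coordinates_eq hab hφ hsub hi hj hij
  exact ⟨x, ⟨hx, hax⟩, hbx⟩

/-! ### Recursive constructions -/

/-- `Q` is what the new term must satisfy relative to the earlier ones; `Inv` is what keeps the
recursion from getting stuck. -/
theorem exists_seq_of_history {α : Type*} [DecidableEq α] (Inv : Finset α → Prop)
    (Q : ℕ → Finset α → α → Prop) (h0 : Inv ∅)
    (h : ∀ n s, Inv s → ∃ y, Q n s y ∧ Inv (insert y s)) :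
    ∃ f : ℕ → α, ∀ n, Q n ((Finset.range n).image f) (f n) := by
  have : Nonempty α := (h 0 ∅ h0).nonempty
  choose! g hgQ hgI using h
  let S : ℕ → Finset α := fun n => Nat.rec ∅ (fun k s => insert (g k s) s) n
  have hS : ∀ n, Inv (S n) := fun n => by
    induction n with
    | zero => exact h0
    | succ k ih => exact hgI k _ ih
  have hSf : ∀ n, S n = (Finset.range n).image fun k => g k (S k) := fun n => by
    induction n with
    | zero => rfl
    | succ k ih =>
      rw [Finset.range_add_one, Finset.image_insert, ← ih]
  exact ⟨fun k => g k (S k), fun n => hSf n ▸ hgQ n _ (hS n)⟩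

/-! ### Partition regular families generated by finite sets -/

/-- When the values cannot be bounded, colouring by residues makes each piece congruent modulo a
number exceeding twice all earlier values. A fixed gap `d` then occurs neither between levels, for
values above `d`, nor inside a high level. -/
theorem exists_sparse_image (P : ℕ → Finset ℕ → Prop)
    (hP : ∀ (κ : Type) [Finite κ] (C : ℕ → κ), ∃ c, ∀ k, ∃ F, (∀ x ∈ F, C x = c) ∧ P k F)
    (φ : ℕ → ℕ) : ∃ F : ℕ → Finset ℕ, (∀ n, P n (F n)) ∧
      ((∃ N, ∀ n, ∀ x ∈ F n, φ x ≤ N) ∨ ((∀ n, ∀ x ∈ F n, 4 ^ n ≤ φ x) ∧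
        ∀ d, 0 < d → {y | y ∈ φ '' (⋃ n, F n) ∧ y + d ∈ φ '' (⋃ n, F n)}.Finite)) := by
  by_cases hb : ∃ N, ∀ k, ∃ F, (∀ x ∈ F, φ x ≤ N) ∧ P k F
  · obtain ⟨N, hN⟩ := hb
    choose F hF hPF using hN
    exact ⟨F, hPF, Or.inl ⟨N, hF⟩⟩
  push Not at hb
  have step : ∀ n M : ℕ, ∃ F, P n F ∧ (∀ x ∈ F, M < φ x) ∧
      ∀ x ∈ F, ∀ y ∈ F, φ x ≡ φ y [MOD M + 1] := by
    intro n M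
    -- The colour `none` marks values at most `M`; it cannot be the good colour, since that would
    -- bound `φ` on pieces of every size.
    obtain ⟨c, hc⟩ := hP (Option (Fin (M + 1)))
      fun x => if φ x ≤ M then none else some (Fin.ofNat (M + 1) (φ x))
    cases c with
    | none =>
      obtain ⟨k, hk⟩ := hb M
      obtain ⟨F, hF, hPF⟩ := hc k
      exact absurd hPF (hk F fun x hx => by simpa using hF x hx)
    | some c =>
      obtain ⟨F, hF, hPF⟩ := hc n
      have hF' : ∀ x ∈ F, M < φ x ∧ φ x % (M + 1) = c := fun x hx => by
        have := hF x hx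
        split_ifs at this with hx'
        refine ⟨by omega, ?_⟩
        rw [← Option.some.inj this]
        rfl
      exact ⟨F, hPF, fun x hx => (hF' x hx).1,
        fun x hx y hy => (hF' x hx).2.trans (hF' y hy).2.symm⟩
  obtain ⟨F, hF⟩ := exists_seq_of_history (fun _ => True)
    (fun n (s : Finset (Finset ℕ)) F => P n F ∧ ∃ M, 4 ^ n ≤ M ∧
      (∀ G ∈ s, ∀ x ∈ G, 2 * φ x ≤ M) ∧ (∀ x ∈ F, M < φ x) ∧
      ∀ x ∈ F, ∀ y ∈ F, φ x ≡ φ y [MOD M + 1]) trivial (fun n s _ => by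
    obtain ⟨F, h1, h2, h3⟩ := step n (4 ^ n + ∑ G ∈ s, ∑ x ∈ G, 2 * φ x)
    refine ⟨F, ⟨h1, _, Nat.le_add_right _ _, fun G hG x hx => ?_, h2, h3⟩, trivial⟩
    exact ((Finset.single_le_sum (f := fun x => 2 * φ x) (fun _ _ => Nat.zero_le _) hx).trans
      (Finset.single_le_sum (f := fun G => ∑ x ∈ G, 2 * φ x) (fun _ _ => Nat.zero_le _) hG)).trans
      (Nat.le_add_left _ _))
  choose hPF M hM hprev hlt hmod using hF
  replace hprev : ∀ m n, m < n → ∀ x ∈ F m, 2 * φ x ≤ M n := fun m n hmn =>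
    hprev n (F m) (Finset.mem_image_of_mem F (Finset.mem_range.2 hmn))
  refine ⟨F, hPF, Or.inr ⟨fun n x hx => (hM n).trans (hlt n x hx).le, fun d hd => ?_⟩⟩
  -- elements of one level are congruent modulo something larger than `d` when the level is high
  refine (Set.finite_Iic (d + ∑ n ∈ Finset.range d, ∑ x ∈ F n, φ x)).subset ?_
  rintro y ⟨⟨u, hu, rfl⟩, v, hv, huv⟩
  by_contra hy
  simp only [Set.mem_Iic, not_le] at hy
  simp only [Set.mem_iUnion, Finset.mem_coe] at hu hv
  obtain ⟨m, hu⟩ := hu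
  obtain ⟨n, hv⟩ := hv
  have hmn : m = n := by
    rcases lt_trichotomy m n with h | h | h
    · have := hprev m n h u hu
      have := hlt n v hv
      omega
    · exact h
    · have := hprev n m h v hv
      have := hlt m u hu
      omega
  subst hmn
  have hdm : d ≤ m := by
    by_contra hdm
    have := (Finset.single_le_sum (f := φ) (fun _ _ => Nat.zero_le _) hu).trans
      (Finset.single_le_sum (f := fun n => ∑ x ∈ F n, φ x) (fun _ _ => Nat.zero_le _)
        (Finset.mem_range.2 (not_le.1 hdm)))
    omega
  have h4 : m < 4 ^ m := Nat.lt_pow_self (by norm_num)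
  have h := (Nat.modEq_iff_dvd' (by omega)).1 (hmod m u hu v hv)
  rw [huv, Nat.add_sub_cancel_left] at h
  have := Nat.le_of_dvd hd h
  have := hM m
  omega

theorem exists_mono_progression (κ : Type) [Finite κ] (C : ℕ → κ) : ∃ c, ∀ k, ∃ F : Finset ℕ,
    (∀ x ∈ F, C x = c) ∧ ∃ a d, 0 < d ∧ F = (Finset.range k).image fun i => a + i * d := by
  by_contra! hcon
  choose k hk using hcon
  cases nonempty_fintype κ
  -- The length `∑ c, k c` dominates the failing length of every colour at once, so one colour
  -- serves all lengths.
  obtain ⟨d, hd, a, c, h⟩ :=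
    Combinatorics.exists_mono_homothetic_copy (Finset.range (∑ c, k c)) C
  refine hk c ((Finset.range (k c)).image fun i => a + i * d) (fun x hx => ?_) a d hd rfl
  obtain ⟨i, hi, rfl⟩ := Finset.mem_image.1 hx
  have := Finset.single_le_sum (f := k) (fun _ _ => Nat.zero_le _) (Finset.mem_univ c)
  have := h i (Finset.mem_range.2 ((Finset.mem_range.1 hi).trans_le this))
  rwa [smul_eq_mul, mul_comm, add_comm] at this

theorem exists_large_sum {A : Set ℕ} (hA : A ∉ summable) (k : ℕ) :
    ∃ F : Finset ℕ, (F : Set ℕ) ⊆ A ∧ (k : ℝ) ≤ ∑ n ∈ F, 1 / ((n : ℝ) + 1) := by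
  classical
  by_contra! hcon
  refine hA (summable_of_sum_le (c := k) (fun _ => by positivity) fun u => ?_)
  have := hcon (u.map (Function.Embedding.subtype _)) (fun x hx => by
    obtain ⟨y, -, rfl⟩ := Finset.mem_map.1 hx
    exact y.2)
  rw [Finset.sum_map] at this
  exact this.le

theorem exists_mono_large_sum (κ : Type) [Finite κ] (C : ℕ → κ) : ∃ c, ∀ k : ℕ, ∃ F : Finset ℕ,
    (∀ x ∈ F, C x = c) ∧ (k : ℝ) ≤ ∑ n ∈ F, 1 / ((n : ℝ) + 1) := by
  suffices h : ∃ c, C ⁻¹' {c} ∉ summable from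
    h.imp fun c hc k => (exists_large_sum hc k).imp fun F hF => ⟨fun x hx => hF.1 hx, hF.2⟩
  by_contra! hcon
  refine univ_notMem_summable ?_
  have key : ∀ s : Set κ, s.Finite → C ⁻¹' s ∈ summable := fun s hs => by
    induction s, hs using Set.Finite.induction_on with
    | empty => exact summable_of_finite (by simp)
    | insert _ _ ih =>
      rw [Set.insert_eq, Set.preimage_union]
      exact summable_union (hcon _) ih
  simpa using key Set.univ Set.finite_univ

theorem iUnion_notMem_vdW {F : ℕ → Finset ℕ}
    (hF : ∀ k, ∃ a d, 0 < d ∧ F k = (Finset.range k).image fun i => a + i * d) :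
    (⋃ n, (F n : Set ℕ)) ∉ vdW := by
  refine not_not.2 fun k => ?_
  obtain ⟨a, d, hd, h⟩ := hF k
  refine ⟨a, d, hd, fun i hi => Set.mem_iUnion.2 ⟨k, ?_⟩⟩
  rw [h]
  exact Finset.mem_coe.2 (Finset.mem_image_of_mem _ (Finset.mem_range.2 hi))

theorem iUnion_notMem_summable {F : ℕ → Finset ℕ}
    (hF : ∀ k : ℕ, (k : ℝ) ≤ ∑ n ∈ F k, 1 / ((n : ℝ) + 1)) :
    (⋃ n, (F n : Set ℕ)) ∉ summable := by
  intro h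
  rw [mem_summable_iff] at h
  obtain ⟨k, hk⟩ := exists_nat_gt
    (∑' n, (⋃ n, (F n : Set ℕ)).indicator (fun n : ℕ => 1 / ((n : ℝ) + 1)) n)
  refine absurd (hF k) (not_le.2 (lt_of_le_of_lt ?_ hk))
  refine le_of_eq_of_le (Finset.sum_congr rfl fun x hx => ?_)
    (h.sum_le_tsum (F k) fun n _ => Set.indicator_nonneg (fun n _ => by positivity) n)
  rw [Set.indicator_of_mem (Set.mem_iUnion.2 ⟨k, Finset.mem_coe.2 hx⟩)]

theorem image_iUnion_finite {φ : ℕ → ℕ} {F : ℕ → Finset ℕ} {N : ℕ}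
    (h : ∀ n, ∀ x ∈ F n, φ x ≤ N) : (φ '' ⋃ n, (F n : Set ℕ)).Finite := by
  refine (Set.finite_Iic N).subset ?_
  rintro _ ⟨x, hx, rfl⟩
  obtain ⟨n, hn⟩ := Set.mem_iUnion.1 hx
  exact h n x hn

theorem not_diff_le_vdW : ¬ IdealLE diff vdW := by
  rintro ⟨φ, hφ⟩
  obtain ⟨F, hF, h⟩ := exists_sparse_image _ exists_mono_progression φ
  refine hφ _ (iUnion_notMem_vdW hF) ?_
  rcases h with ⟨N, h⟩ | ⟨-, h⟩
  exacts [diff_of_finite (image_iUnion_finite h), diff_of_finite_gaps h]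

theorem not_diff_le_summable : ¬ IdealLE diff summable := by
  rintro ⟨φ, hφ⟩
  obtain ⟨F, hF, h⟩ := exists_sparse_image _ exists_mono_large_sum φ
  refine hφ _ (iUnion_notMem_summable hF) ?_
  rcases h with ⟨N, h⟩ | ⟨-, h⟩
  exacts [diff_of_finite (image_iUnion_finite h), diff_of_finite_gaps h]

theorem not_summable_le_vdW : ¬ IdealLE summable vdW := by
  rintro ⟨φ, hφ⟩
  obtain ⟨F, hF, h⟩ := exists_sparse_image _ exists_mono_progression φ
  refine hφ _ (iUnion_notMem_vdW hF) ?_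
  rcases h with ⟨N, h⟩ | ⟨h, -⟩
  · exact summable_of_finite (image_iUnion_finite h)
  refine summable_of_subset_iUnion (fun n => (F n).image φ) ?_ (fun n => ?_) ?_
  · rintro _ ⟨x, hx, rfl⟩
    obtain ⟨n, hn⟩ := Set.mem_iUnion.1 hx
    exact ⟨n, Finset.mem_image_of_mem φ hn⟩
  · obtain ⟨a, d, -, hFn⟩ := hF n
    refine Finset.card_image_le.trans (hFn ▸ Finset.card_image_le.trans ?_)
    have : n < 2 ^ n := Nat.lt_two_pow_self
    rw [Finset.card_range]
    omega
  · intro n x hx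
    obtain ⟨y, hy, rfl⟩ := Finset.mem_image.1 hx
    exact h n y hy

/-! ### Functions on pairs along a nonprincipal ultrafilter -/

theorem eventually_const_or_gt {X : Type*} (p : Ultrafilter X) (g : X → ℕ) :
    (∃ c, ∀ᶠ x in p, g x = c) ∨ ∀ N, ∀ᶠ x in p, N < g x := by
  refine or_iff_not_imp_left.2 fun h N => ?_
  have h' := (eventually_all_finset (Finset.range (N + 1))).2
    fun c _ => Ultrafilter.eventually_not.2 (not_exists.1 h c)
  filter_upwards [h'] with x hx
  by_contra hN
  exact hx (g x) (Finset.mem_range.2 (by omega)) rfl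

theorem eventually_lt_hyperfilter (s : Finset ℕ) : ∀ᶠ y in hyperfilter ℕ, ∀ i ∈ s, i < y :=
  (eventually_all_finset s).2 fun i _ => Nat.hyperfilter_le_atTop (eventually_gt_atTop i)

theorem exists_strictMono_of_hyperfilter (Inv : Finset ℕ → Prop) (Q : ℕ → Finset ℕ → ℕ → Prop)
    (h0 : Inv ∅) (h : ∀ n s, Inv s → ∀ᶠ y in hyperfilter ℕ, Q n s y ∧ Inv (insert y s)) :
    ∃ f : ℕ → ℕ, StrictMono f ∧ ∀ n, Q n ((Finset.range n).image f) (f n) := by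
  obtain ⟨f, hf⟩ := exists_seq_of_history Inv (fun n s y => Q n s y ∧ ∀ i ∈ s, i < y) h0
    fun n s hs => by
      obtain ⟨y, ⟨h1, h2⟩, h3⟩ := ((h n s hs).and (eventually_lt_hyperfilter s)).exists
      exact ⟨y, ⟨h1, h3⟩, h2⟩
  exact ⟨f, strictMono_nat_of_lt_succ fun n => (hf (n + 1)).2 _
    (Finset.mem_image_of_mem f (Finset.self_mem_range_succ n)), fun n => (hf n).1⟩

theorem exists_pair_function (φ : Pairs → ℕ) : ∃ f : ℕ → ℕ → ℕ, ∀ h : ℕ → ℕ, StrictMono h →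
    ∀ y ∈ φ '' r.map (Set.range h), ∃ i n, i < n ∧ f (h i) (h n) = y := by
  -- The value 0 on the diagonal is a dummy.
  refine ⟨fun i n => if hin : i ≠ n then φ ⟨{i, n}, Finset.card_pair hin⟩ else 0, ?_⟩
  rintro h hh _ ⟨⟨p, hp⟩, hpH, rfl⟩
  obtain ⟨u, v, huv, rfl⟩ := Finset.card_eq_two.1 hp
  simp only [r, Finset.coe_pair, Set.mem_ofPred_eq, Set.insert_subset_iff,
    Set.singleton_subset_iff] at hpH
  obtain ⟨⟨i, rfl⟩, n, rfl⟩ := hpH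
  rcases lt_trichotomy i n with hin | rfl | hin
  · exact ⟨i, n, hin, dif_pos huv⟩
  · exact absurd rfl huv
  · refine ⟨n, i, hin, ?_⟩
    refine (dif_pos huv.symm).trans ?_
    congr 2
    exact Finset.pair_comm _ _

theorem eventually_finite_limit_or (p : Ultrafilter ℕ) (f : ℕ → ℕ → ℕ) :
    (∃ g : ℕ → ℕ, ∀ᶠ i in p, ∀ᶠ x in p, f i x = g i) ∨
      ∀ᶠ i in p, ∀ N, ∀ᶠ x in p, N < f i x := by
  rcases Ultrafilter.eventually_or.1 (Eventually.of_forall (f := (p : Filter ℕ))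
    fun i => eventually_const_or_gt p (f i)) with h | h
  · left
    have : ∀ i, ∃ c, (∃ c, ∀ᶠ x in p, f i x = c) → ∀ᶠ x in p, f i x = c :=
      fun i => by
        by_cases hi : ∃ c, ∀ᶠ x in p, f i x = c
        · exact hi.imp fun c hc _ => hc
        · exact ⟨0, fun h => absurd h hi⟩
    choose g hg using this
    exact ⟨g, h.mono fun i hi => hg i hi⟩
  · exact Or.inr h

/-- According to the iterated limits, the image is a single point, or one value above `4 ^ n` for
each lower index `n`, or `n` values above `4 ^ n` for each upper index `n`. -/
theorem not_summable_le_ramsey : ¬ IdealLE summable ramsey := by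
  refine not_idealLE_of_forall fun φ => ?_
  obtain ⟨f, hf⟩ := exists_pair_function φ
  rcases eventually_finite_limit_or (hyperfilter ℕ) f with ⟨g, hg⟩ | hinf
  · rcases eventually_const_or_gt (hyperfilter ℕ) g with ⟨c, hc⟩ | hgt
    · obtain ⟨h, hh, hQ⟩ := exists_strictMono_of_hyperfilter
        (fun s => ∀ i ∈ s, ∀ᶠ x in hyperfilter ℕ, f i x = c) (fun _ s y => ∀ i ∈ s, f i y = c)
        (by simp) fun n s hs => by
          filter_upwards [(eventually_all_finset s).2 hs, hg, hc] with y h1 h2 h3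
          refine ⟨h1, fun i hi => ?_⟩
          rcases Finset.mem_insert.1 hi with rfl | hi
          exacts [h3 ▸ h2, hs i hi]
      refine ⟨Set.range h, Set.infinite_range_of_injective hh.injective, summable_of_finite ?_⟩
      refine (Set.finite_singleton c).subset fun y hy => ?_
      obtain ⟨i, n, hin, rfl⟩ := hf h hh y hy
      exact hQ n _ (Finset.mem_image_of_mem h (Finset.mem_range.2 hin))
    · obtain ⟨h, hh, hQ⟩ := exists_strictMono_of_hyperfilter
        (fun s => ∀ i ∈ s, ∀ᶠ x in hyperfilter ℕ, f i x = g i)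
        (fun n s y => (∀ i ∈ s, f i y = g i) ∧ 4 ^ n < g y)
        (by simp) fun n s hs => by
          filter_upwards [(eventually_all_finset s).2 hs, hg, hgt (4 ^ n)] with y h1 h2 h3
          refine ⟨⟨h1, h3⟩, fun i hi => ?_⟩
          rcases Finset.mem_insert.1 hi with rfl | hi
          exacts [h2, hs i hi]
      refine ⟨Set.range h, Set.infinite_range_of_injective hh.injective,
        summable_of_subset_iUnion (fun n => {g (h n)}) (fun y hy => ?_) (fun n => ?_) ?_⟩
      · obtain ⟨i, n, hin, rfl⟩ := hf h hh y hy
        exact ⟨i, by simp [(hQ n).1 _ (Finset.mem_image_of_mem h (Finset.mem_range.2 hin))]⟩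
      · have := Nat.one_le_two_pow (n := n)
        rw [Finset.card_singleton]
        omega
      · intro n x hx
        rw [Finset.mem_singleton.1 hx]
        exact (hQ n).2.le
  · obtain ⟨h, hh, hQ⟩ := exists_strictMono_of_hyperfilter
      (fun s => ∀ i ∈ s, ∀ N, ∀ᶠ x in hyperfilter ℕ, N < f i x)
      (fun n s y => ∀ i ∈ s, 4 ^ n < f i y) (by simp) fun n s hs => by
        filter_upwards [(eventually_all_finset s).2 fun i hi => hs i hi (4 ^ n), hinf] with y h1 h2
        refine ⟨h1, fun i hi => ?_⟩
        rcases Finset.mem_insert.1 hi with rfl | hi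
        exacts [h2, hs i hi]
    refine ⟨Set.range h, Set.infinite_range_of_injective hh.injective,
      summable_of_subset_iUnion (fun n => (Finset.range n).image fun i => f (h i) (h n))
        (fun y hy => ?_) (fun n => ?_) ?_⟩
    · obtain ⟨i, n, hin, rfl⟩ := hf h hh y hy
      exact ⟨n, Finset.mem_image.2 ⟨i, Finset.mem_range.2 hin, rfl⟩⟩
    · have : n < 2 ^ n := Nat.lt_two_pow_self
      refine Finset.card_image_le.trans ?_
      rw [Finset.card_range]
      omega
    · intro n x hx
      obtain ⟨i, hi, rfl⟩ := Finset.mem_image.1 hx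
      exact (hQ n _ (Finset.mem_image_of_mem h hi)).le

/-- The values `f i x`, `i ∈ s`, contain no four distinct numbers `u < v < w < z` with
`u + z = v + w`. -/
def SquareFreeAt (f : ℕ → ℕ → ℕ) (s : Finset ℕ) (x : ℕ) : Prop :=
  ∀ i ∈ s, ∀ j ∈ s, ∀ k ∈ s, ∀ l ∈ s, f i x < f j x → f j x < f k x → f k x < f l x →
    f i x + f l x ≠ f j x + f k x

/-- Either almost all germs of the functions `f l` coincide, and no two distinct values occur, or
almost every new germ avoids all relations `f l + f k = f i + f j` with old ones. -/
theorem exists_squareFree_invariant (f : ℕ → ℕ → ℕ) : ∃ Inv : Finset ℕ → Prop, Inv ∅ ∧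
    (∀ s, Inv s → ∀ᶠ l in hyperfilter ℕ, Inv (insert l s)) ∧
    ∀ s, Inv s → ∀ᶠ x in hyperfilter ℕ, SquareFreeAt f s x := by
  by_cases hconst : ∃ l₀, ∀ᶠ l in hyperfilter ℕ, ∀ᶠ x in hyperfilter ℕ, f l x = f l₀ x
  · obtain ⟨l₀, hl₀⟩ := hconst
    refine ⟨fun s => ∀ l ∈ s, ∀ᶠ x in hyperfilter ℕ, f l x = f l₀ x, by simp, fun s hs => ?_,
      fun s hs => ?_⟩
    · filter_upwards [hl₀] with l hl i hi
      rcases Finset.mem_insert.1 hi with rfl | hi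
      exacts [hl, hs i hi]
    · filter_upwards [(eventually_all_finset s).2 hs] with x hx i hi j hj k hk l hl hij
      rw [hx i hi, hx j hj] at hij
      exact absurd hij (lt_irrefl _)
  have sidon : ∀ i j k, ∀ᶠ l in hyperfilter ℕ, ∀ᶠ x in hyperfilter ℕ,
      f l x + f k x ≠ f i x + f j x := by
    intro i j k
    simp only [ne_eq, Ultrafilter.eventually_not]
    intro h
    -- The relation determines the germ of `f l` from `i`, `j`, `k`; if it held for almost all `l`,
    -- those germs would coincide.
    obtain ⟨l₀, hl₀⟩ := h.exists
    refine hconst ⟨l₀, h.mono fun l hl => ?_⟩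
    filter_upwards [hl, hl₀] with x h1 h2
    omega
  refine ⟨fun s => ∀ᶠ x in hyperfilter ℕ, SquareFreeAt f s x, by simp [SquareFreeAt],
    fun s hs => ?_, fun s hs => hs⟩
  have := (eventually_all_finset s).2 fun i _ => (eventually_all_finset s).2 fun j _ =>
    (eventually_all_finset s).2 fun k _ => sidon i j k
  filter_upwards [this] with a ha
  have ha' := (eventually_all_finset s).2 fun i hi => (eventually_all_finset s).2 fun j hj =>
    (eventually_all_finset s).2 fun k hk => ha i hi j hj k hk
  filter_upwards [hs, ha'] with x hx hax i hi j hj k hk l hl hij hjk hkl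
  rw [Finset.mem_insert] at hi hj hk hl
  -- The strict inequalities allow the new index to appear at most once among the four.
  rcases hi with rfl | hi <;> rcases hj with rfl | hj <;> rcases hk with rfl | hk <;>
    rcases hl with rfl | hl <;> try omega
  · have := hax j hj k hk l hl
    omega
  · have := hax i hi l hl k hk
    omega
  · have := hax i hi l hl j hj
    omega
  · have := hax j hj k hk i hi
    omega
  · exact hx i hi j hj k hk l hl hij hjk hkl

/-- All four points of a pattern are brought to a common upper index, where `SquareFreeAt` excludes
them: by moving to a later index when the limits are finite, and by doubling growth between levels
when they are infinite. -/
theorem not_hindman_le_ramsey : ¬ IdealLE hindman ramsey := by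
  refine not_idealLE_of_forall fun φ => ?_
  obtain ⟨f, hf⟩ := exists_pair_function φ
  obtain ⟨Inv, hInv0, hInv, hsq⟩ := exists_squareFree_invariant f
  rcases eventually_finite_limit_or (hyperfilter ℕ) f with ⟨g, hg⟩ | hinf
  · obtain ⟨h, hh, hQ⟩ := exists_strictMono_of_hyperfilter
      (fun s => Inv s ∧ ∀ i ∈ s, ∀ᶠ x in hyperfilter ℕ, f i x = g i)
      (fun _ s y => SquareFreeAt f s y ∧ ∀ i ∈ s, f i y = g i) (by simp [hInv0])
      fun n s hs => by
        filter_upwards [(eventually_all_finset s).2 hs.2, hg, hsq s hs.1, hInv s hs.1]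
          with y h1 h2 h3 h4
        refine ⟨⟨h3, h1⟩, h4, fun i hi => ?_⟩
        rcases Finset.mem_insert.1 hi with rfl | hi
        exacts [h2, hs.2 i hi]
    have hval : ∀ i n, i < n → f (h i) (h n) = g (h i) := fun i n hin =>
      (hQ n).2 _ (Finset.mem_image_of_mem h (Finset.mem_range.2 hin))
    refine ⟨Set.range h, Set.infinite_range_of_injective hh.injective,
      hindman_of_finite_squares fun a b ha hab => ?_⟩
    refine Set.finite_empty.subset ?_
    rintro y ⟨h1, h2, h3, h4⟩
    obtain ⟨i, _, hi, e1⟩ := hf h hh _ h1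
    obtain ⟨j, _, hj, e2⟩ := hf h hh _ h2
    obtain ⟨k, _, hk, e3⟩ := hf h hh _ h3
    obtain ⟨l, _, hl, e4⟩ := hf h hh _ h4
    rw [hval _ _ hi] at e1
    rw [hval _ _ hj] at e2
    rw [hval _ _ hk] at e3
    rw [hval _ _ hl] at e4
    -- Values do not depend on the upper index, so any index above all four lower ones will do.
    have hn : ∀ m ≤ i + j + k + l, h m ∈ (Finset.range (i + j + k + l + 1)).image h :=
      fun m hm => Finset.mem_image_of_mem h (Finset.mem_range.2 (by omega))
    have := (hQ (i + j + k + l + 1)).1 (h i) (hn i (by omega)) (h j) (hn j (by omega))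
      (h k) (hn k (by omega)) (h l) (hn l (by omega))
    rw [hval i _ (by omega), hval j _ (by omega), hval k _ (by omega), hval l _ (by omega)] at this
    exact this (by omega) (by omega) (by omega) (by omega)
  · obtain ⟨h, hh, hQ⟩ := exists_strictMono_of_hyperfilter
      (fun s => Inv s ∧ ∀ i ∈ s, ∀ N, ∀ᶠ x in hyperfilter ℕ, N < f i x)
      (fun _ s y => SquareFreeAt f s y ∧ ∀ i ∈ s, ∀ j ∈ s, ∀ k ∈ s, 2 * f j k < f i y)
      (by simp [hInv0]) fun n s hs => by
        have hb := (eventually_all_finset s).2 fun i hi => (eventually_all_finset s).2 fun j _ =>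
          (eventually_all_finset s).2 fun k _ => hs.2 i hi (2 * f j k)
        filter_upwards [hb, hinf, hsq s hs.1, hInv s hs.1] with y h1 h2 h3 h4
        refine ⟨⟨h3, h1⟩, h4, fun i hi => ?_⟩
        rcases Finset.mem_insert.1 hi with rfl | hi
        exacts [h2, hs.2 i hi]
    have hmem : ∀ i n, i < n → h i ∈ (Finset.range n).image h := fun i n hin =>
      Finset.mem_image_of_mem h (Finset.mem_range.2 hin)
    have hgrow : ∀ i m j n, i < m → m < n → j < n → 2 * f (h i) (h m) < f (h j) (h n) :=
      fun i m j n him hmn hjn => (hQ n).2 _ (hmem j n hjn) _ (hmem i n (him.trans hmn)) _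
        (hmem m n hmn)
    refine ⟨Set.range h, Set.infinite_range_of_injective hh.injective,
      hindman_of_finite_squares fun a b ha hab => (Set.finite_Iic (a + b)).subset ?_⟩
    rintro y ⟨h1, h2, h3, h4⟩
    by_contra hy
    simp only [Set.mem_Iic, not_le] at hy
    obtain ⟨i, n, hi, e1⟩ := hf h hh _ h1
    have hlev : ∀ z ∈ φ '' r.map (Set.range h), y ≤ z → z < 2 * y →
        ∃ j < n, f (h j) (h n) = z := by
      intro z hz hyz hzy
      obtain ⟨j, m, hj, e⟩ := hf h hh z hz
      rcases lt_trichotomy m n with hmn | rfl | hmn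
      · have := hgrow j m i n hj hmn hi
        omega
      · exact ⟨j, hj, e⟩
      · have := hgrow i n j m hi hmn hj
        omega
    obtain ⟨j, hj, e2⟩ := hlev _ h2 (by omega) (by omega)
    obtain ⟨k, hk, e3⟩ := hlev _ h3 (by omega) (by omega)
    obtain ⟨l, hl, e4⟩ := hlev _ h4 (by omega) (by omega)
    exact (hQ n).1 _ (hmem i n hi) _ (hmem j n hj) _ (hmem k n hk) _ (hmem l n hl)
      (by omega) (by omega) (by omega) (by omega)

/-! ### Functions on finite sums along an idempotent ultrafilter -/

/-- Idempotent nonprincipal ultrafilters on `ℕ`. -/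
def IsFreeIdempotent (p : Ultrafilter ℕ) : Prop :=
  (∀ N, ∀ᶠ x in (p : Filter ℕ), N < x) ∧
    ∀ P : ℕ → Prop, (∀ᶠ x in (p : Filter ℕ), P x) ↔
      ∀ᶠ x in (p : Filter ℕ), ∀ᶠ y in (p : Filter ℕ), P (x + y)

-- The Ellis–Numakura lemma is applied over `ℕ+`, to avoid the principal idempotent at 0; a
-- principal idempotent at `c` would force `c + c = c`.
attribute [local instance] Ultrafilter.add Ultrafilter.addSemigroup in
theorem exists_isFreeIdempotent : ∃ p : Ultrafilter ℕ, IsFreeIdempotent p := by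
  obtain ⟨q, hq⟩ := exists_idempotent_of_compact_t2_of_continuous_add_left
    (Ultrafilter.continuous_add_left (M := ℕ+))
  have hq' : ∀ P : ℕ+ → Prop, (∀ᶠ x in q, P x) ↔ ∀ᶠ x in q, ∀ᶠ y in q, P (x + y) := fun P => by
    conv_lhs => rw [← hq]
    exact Ultrafilter.eventually_add q q P
  refine ⟨q.map (fun x : ℕ+ => (x : ℕ)), ?_, fun P => hq' fun x => P x⟩
  rcases eventually_const_or_gt q (fun x : ℕ+ => (x : ℕ)) with ⟨c, hc⟩ | h
  · obtain ⟨x, hx, h⟩ := (hc.and ((hq' _).1 hc)).exists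
    obtain ⟨y, hy, h⟩ := (hc.and h).exists
    have := y.pos
    rw [PNat.add_coe] at h
    omega
  · exact h

/-- `X n` collects the sums of the first `n` terms. Each such sum `x` is kept in `G` with `x + y ∈
G` for almost all `y`, which idempotence lets survive the next step. -/
theorem exists_strictMono_sums {p : Ultrafilter ℕ} (hp : IsFreeIdempotent p) {G : Set ℕ}
    (hG : ∀ᶠ x in p, x ∈ G) (Q : ℕ → Finset ℕ → ℕ → Prop)
    (hQ : ∀ n X, (∀ x ∈ X, x ∈ G) → ∀ᶠ y in p, Q n X y) :
    ∃ (d : ℕ → ℕ) (X : ℕ → Finset ℕ), StrictMono d ∧ (∀ n, ∀ x ∈ X n, x ∈ G) ∧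
      (∀ n, ∀ s ⊆ Finset.range n, s.Nonempty → ∑ i ∈ s, d i ∈ X n) ∧
      (∀ n, (X n).card < 2 ^ n) ∧ ∀ n, Q n (X n) (d n) := by
  have step : ∀ n (X : Finset ℕ), (∀ x ∈ X, x ∈ G ∧ ∀ᶠ y in p, x + y ∈ G) →
      ∃ y, (Q n X y ∧ ∀ x ∈ X, x < y) ∧
        ∀ x ∈ X ∪ insert y (X.image fun x => x + y), x ∈ G ∧ ∀ᶠ y in p, x + y ∈ G := by
    intro n X hX
    have h1 := (eventually_all_finset X).2 fun x hx => (hX x hx).2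
    have h2 := (eventually_all_finset X).2 fun x hx => (hp.2 fun y => x + y ∈ G).1 (hX x hx).2
    obtain ⟨y, h⟩ := (h1.and <| h2.and <| hG.and <| ((hp.2 _).1 hG).and <|
      (hQ n X fun x hx => (hX x hx).1).and <|
      (eventually_all_finset X).2 fun x _ => hp.1 x).exists
    obtain ⟨h1, h2, h3, h4, h5, h6⟩ := h
    refine ⟨y, ⟨h5, h6⟩, fun x hx => ?_⟩
    rcases Finset.mem_union.1 hx with hx | hx
    · exact hX x hx
    rcases Finset.mem_insert.1 hx with rfl | hx
    · exact ⟨h3, h4⟩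
    obtain ⟨z, hz, rfl⟩ := Finset.mem_image.1 hx
    exact ⟨h1 z hz, by simpa only [add_assoc] using h2 z hz⟩
  choose! g hg hgI using step
  let X : ℕ → Finset ℕ :=
    fun n => Nat.rec ∅ (fun k X => X ∪ insert (g k X) (X.image fun x => x + g k X)) n
  have hXs : ∀ n, X (n + 1) = X n ∪ insert (g n (X n)) ((X n).image fun x => x + g n (X n)) :=
    fun n => rfl
  have hX : ∀ n, ∀ x ∈ X n, x ∈ G ∧ ∀ᶠ y in p, x + y ∈ G := fun n => by
    induction n with
    | zero => exact fun x hx => absurd hx (Finset.notMem_empty x)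
    | succ k ih => exact hgI k _ ih
  refine ⟨fun n => g n (X n), X, ?_, fun n x hx => (hX n x hx).1, fun n => ?_, fun n => ?_,
    fun n => (hg n _ (hX n)).1⟩
  · refine strictMono_nat_of_lt_succ fun n => (hg (n + 1) _ (hX (n + 1))).2 _ ?_
    rw [hXs]
    simp
  · induction n with
    | zero =>
      intro s hs hne
      rw [Finset.range_zero, Finset.subset_empty] at hs
      exact absurd hs hne.ne_empty
    | succ n ih =>
      intro s hs hne
      rw [hXs]
      have hs' : s.erase n ⊆ Finset.range n := by
        rw [Finset.range_add_one] at hs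
        exact fun i hi => (Finset.mem_insert.1 (hs (Finset.mem_of_mem_erase hi))).resolve_left
          (Finset.ne_of_mem_erase hi)
      by_cases hn : n ∈ s
      · refine Finset.mem_union_right _ ?_
        rw [← Finset.sum_erase_add _ _ hn]
        rcases (s.erase n).eq_empty_or_nonempty with h | h
        · rw [h]
          simp
        · exact Finset.mem_insert_of_mem (Finset.mem_image_of_mem (fun x => x + g n (X n))
            (ih _ hs' h))
      · rw [Finset.erase_eq_of_notMem hn] at hs'
        exact Finset.mem_union_left _ (ih s hs' hne)
  · induction n with
    | zero => simp [X]
    | succ n ih =>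
      rw [hXs]
      have h1 := Finset.card_union_le (X n)
        (insert (g n (X n)) ((X n).image fun x => x + g n (X n)))
      have h2 := Finset.card_insert_le (g n (X n)) ((X n).image fun x => x + g n (X n))
      have h3 := Finset.card_image_le (s := X n) (f := fun x => x + g n (X n))
      rw [pow_succ]
      omega

theorem eq_or_eq_add_of_sums {d : ℕ → ℕ} {X : ℕ → Finset ℕ}
    (hX : ∀ n, ∀ s ⊆ Finset.range n, s.Nonempty → ∑ i ∈ s, d i ∈ X n) {s : Finset ℕ}
    (hs : s.Nonempty) : ∃ n, ∑ i ∈ s, d i = d n ∨ ∃ x ∈ X n, ∑ i ∈ s, d i = x + d n := by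
  refine ⟨s.max' hs, ?_⟩
  rw [← Finset.sum_erase_add _ _ (s.max'_mem hs)]
  rcases (s.erase (s.max' hs)).eq_empty_or_nonempty with h | h
  · left
    rw [h]
    simp
  · refine Or.inr ⟨_, hX _ _ (fun i hi => Finset.mem_range.2 ?_) h, rfl⟩
    exact s.lt_max'_of_mem_erase_max' hs hi

theorem mem_of_sums {d : ℕ → ℕ} {X : ℕ → Finset ℕ} {G : Set ℕ} (hG : ∀ n, ∀ x ∈ X n, x ∈ G)
    (hX : ∀ n, ∀ s ⊆ Finset.range n, s.Nonempty → ∑ i ∈ s, d i ∈ X n) {s : Finset ℕ}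
    (hs : s.Nonempty) : ∑ i ∈ s, d i ∈ G := by
  obtain ⟨n, hn⟩ := s.exists_nat_subset_range
  exact hG n _ (hX n s hn hs)

theorem exists_index_of_mem_FS {d : ℕ → ℕ} (hd : StrictMono d) {x : ℕ}
    (hx : x ∈ FS.map (Set.range d)) : ∃ s : Finset ℕ, s.Nonempty ∧ ∑ i ∈ s, d i = x := by
  obtain ⟨α, hα, hsub, rfl⟩ := hx
  rw [← Set.image_univ, Finset.subset_set_image_iff] at hsub
  obtain ⟨s, -, rfl⟩ := hsub
  exact ⟨s, Finset.image_nonempty.1 hα, (Finset.sum_image (f := fun i => i) hd.injective.injOn).symm⟩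

/-- In the middle case `α x` is the limit of `a (x + y)` in `y`. Associativity and idempotence make
it invariant under adding almost any later `y`. -/
theorem IsFreeIdempotent.trichotomy {p : Ultrafilter ℕ} (hp : IsFreeIdempotent p) (a : ℕ → ℕ) :
    (∃ c, ∀ᶠ x in p, a x = c) ∨ (∀ N, ∀ᶠ x in p, N < a x) ∧
      ((∃ α : ℕ → ℕ, (∀ N, ∀ᶠ x in p, N < α x) ∧
        ∀ᶠ x in p, ∀ᶠ y in p, a (x + y) = α x ∧ α (x + y) = α x) ∨
      ∀ᶠ x in p, ∀ N, ∀ᶠ y in p, N < a (x + y)) := by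
  refine (eventually_const_or_gt p a).imp_right fun hgt => ⟨hgt, ?_⟩
  refine (eventually_finite_limit_or p fun x y => a (x + y)).imp_left ?_
  rintro ⟨α, hα⟩
  refine ⟨α, ?_, ?_⟩
  · refine (eventually_const_or_gt p α).resolve_left ?_
    rintro ⟨c, hc⟩
    have h : ∀ᶠ x in p, a x = c := (hp.2 _).2 <| by
      filter_upwards [hα, hc] with x h1 h2
      rwa [h2] at h1
    obtain ⟨x, h1, h2⟩ := (h.and (hgt c)).exists
    omega
  · filter_upwards [hα, (hp.2 _).1 hα] with x h1 h2
    filter_upwards [h1, h2, (hp.2 _).1 h1] with y h3 h4 h5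
    -- The value `a (x + y + z)` is both `α (x + y)` and `α x`.
    obtain ⟨z, h6, h7⟩ := (h4.and h5).exists
    rw [← add_assoc] at h7
    exact ⟨h3, h6.symm.trans h7⟩

/-- Stripping off the largest index never changes `α`, so only the smallest index matters; `a`
itself agrees with `α` once there is a second term. -/
theorem exists_min_of_stable {d a α : ℕ → ℕ} {X : ℕ → Finset ℕ}
    (hX : ∀ n, ∀ s ⊆ Finset.range n, s.Nonempty → ∑ i ∈ s, d i ∈ X n)
    (hst : ∀ n, ∀ x ∈ X n, a (x + d n) = α x ∧ α (x + d n) = α x) {s : Finset ℕ}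
    (hs : s.Nonempty) : α (∑ i ∈ s, d i) = α (d (s.min' hs)) ∧
      (s = {s.min' hs} ∨ a (∑ i ∈ s, d i) = α (d (s.min' hs))) := by
  suffices h : ∃ m ∈ s, (∀ i ∈ s, m ≤ i) ∧ α (∑ i ∈ s, d i) = α (d m) ∧
      (s = {m} ∨ a (∑ i ∈ s, d i) = α (d m)) by
    obtain ⟨m, hm, hle, h⟩ := h
    rwa [show s.min' hs = m from le_antisymm (s.min'_le m hm) (hle _ (s.min'_mem hs))]
  induction s using Finset.induction_on_max with
  | empty => exact absurd hs Finset.not_nonempty_empty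
  | insert n s hlt ih =>
    rcases s.eq_empty_or_nonempty with rfl | hne
    · exact ⟨n, by simp⟩
    obtain ⟨m, hm, hle, h1, -⟩ := ih hne
    have hn : n ∉ s := fun h => lt_irrefl _ (hlt n h)
    have := hst n _ (hX n s (fun i hi => Finset.mem_range.2 (hlt i hi)) hne)
    rw [Finset.sum_insert hn, add_comm]
    refine ⟨m, Finset.mem_insert_of_mem hm, fun i hi => ?_, this.2.trans h1,
      Or.inr (this.1.trans h1)⟩
    rcases Finset.mem_insert.1 hi with rfl | hi
    exacts [(hlt m hm).le, hle i hi]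

/-- The image is a point, or has two values per smallest index, or fewer than `2 * 2 ^ n` values
with largest index `n`, each exceeding `4 ^ n` at its level `n` in the last two cases. -/
theorem not_summable_le_hindman : ¬ IdealLE summable hindman := by
  refine not_idealLE_of_forall fun f => ?_
  obtain ⟨p, hp⟩ := exists_isFreeIdempotent
  rcases hp.trichotomy f with ⟨c, hc⟩ | ⟨hf, ⟨α, hα, hst⟩ | hinf⟩
  · obtain ⟨d, X, hd, hG, hX, -, -⟩ := exists_strictMono_sums hp hc (fun _ _ _ => True)
      fun _ _ _ => Eventually.of_forall fun _ => trivial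
    refine ⟨Set.range d, Set.infinite_range_of_injective hd.injective,
      summable_of_finite ((Set.finite_singleton c).subset ?_)⟩
    rintro _ ⟨x, hx, rfl⟩
    obtain ⟨s, hs, rfl⟩ := exists_index_of_mem_FS hd hx
    exact mem_of_sums hG hX hs
  · obtain ⟨d, X, hd, hG, hX, -, hQ⟩ := exists_strictMono_sums hp hst
      (fun n X y => (∀ x ∈ X, f (x + y) = α x ∧ α (x + y) = α x) ∧ 4 ^ n < f y ∧ 4 ^ n < α y)
      fun n X h => ((eventually_all_finset X).2 h).and ((hf _).and (hα _))
    refine ⟨Set.range d, Set.infinite_range_of_injective hd.injective,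
      summable_of_subset_iUnion (fun n => {f (d n), α (d n)}) ?_ (fun n => ?_) fun n x hx => ?_⟩
    · rintro _ ⟨x, hx, rfl⟩
      obtain ⟨s, hs, rfl⟩ := exists_index_of_mem_FS hd hx
      refine ⟨s.min' hs, ?_⟩
      have h := (exists_min_of_stable hX (fun n => (hQ n).1) hs).2
      generalize s.min' hs = m at h ⊢
      rcases h with h | h <;> simp [h]
    · have := Nat.one_le_two_pow (n := n)
      have := Finset.card_le_two (a := f (d n)) (b := α (d n))
      omega
    · rcases Finset.mem_insert.1 hx with rfl | hx
      · exact (hQ n).2.1.le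
      · rw [Finset.mem_singleton.1 hx]
        exact (hQ n).2.2.le
  · obtain ⟨d, X, hd, hG, hX, hcard, hQ⟩ := exists_strictMono_sums hp hinf
      (fun n X y => (∀ x ∈ X, 4 ^ n < f (x + y)) ∧ 4 ^ n < f y)
      fun n X h => ((eventually_all_finset X).2 fun x hx => h x hx _).and (hf _)
    refine ⟨Set.range d, Set.infinite_range_of_injective hd.injective,
      summable_of_subset_iUnion (fun n => insert (f (d n)) ((X n).image fun x => f (x + d n)))
        ?_ (fun n => ?_) fun n x hx => ?_⟩
    · rintro _ ⟨x, hx, rfl⟩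
      obtain ⟨s, hs, rfl⟩ := exists_index_of_mem_FS hd hx
      obtain ⟨n, h | ⟨x, hxn, h⟩⟩ := eq_or_eq_add_of_sums hX hs
      · exact ⟨n, by simp [h]⟩
      · exact ⟨n, h ▸ Finset.mem_insert_of_mem (Finset.mem_image_of_mem _ hxn)⟩
    · have h1 := Finset.card_insert_le (f (d n)) ((X n).image fun x => f (x + d n))
      have h2 := Finset.card_image_le (s := X n) (f := fun x => f (x + d n))
      have h3 := hcard n
      omega
    · rcases Finset.mem_insert.1 hx with rfl | hx
      · exact (hQ n).2.le
      · obtain ⟨z, hz, rfl⟩ := Finset.mem_image.1 hx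
        exact ((hQ n).1 z hz).le

/-- Here `a` depends on the smallest index and `b` is governed by the largest. Summing consecutive
pairs makes the smallest index even and the largest odd, so they never coincide, and rules out
one-term sums. -/
theorem exists_disjoint_coordinates {p : Ultrafilter ℕ} (hp : IsFreeIdempotent p)
    {a b α : ℕ → ℕ} (hα : ∀ N, ∀ᶠ x in p, N < α x)
    (hst : ∀ᶠ x in p, ∀ᶠ y in p, a (x + y) = α x ∧ α (x + y) = α x)
    (hb : ∀ᶠ x in p, ∀ N, ∀ᶠ y in p, N < b (x + y)) :
    ∃ D : Set ℕ, D.Infinite ∧ ∀ x ∈ FS.map D, ∀ y ∈ FS.map D, a x ≠ b y := by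
  obtain ⟨e, X, he, hG, hX, -, hQ⟩ := exists_strictMono_sums hp (hst.and hb)
    (fun n X y => (∀ x ∈ X, a (x + y) = α x ∧ α (x + y) = α x) ∧
      (∀ x ∈ X, ∀ z ∈ X, α z < b (x + y)) ∧ ∀ z ∈ X, b z < α y)
    fun n X h => ((eventually_all_finset X).2 fun x hx => (h x hx).1).and
      (((eventually_all_finset X).2 fun x hx => (eventually_all_finset X).2
        fun z _ => (h x hx).2 _).and ((eventually_all_finset X).2 fun z _ => hα _))
  have hd : StrictMono fun n => e (2 * n) + e (2 * n + 1) := fun m n hmn => by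
    have h1 := he (show 2 * m < 2 * n by omega)
    have h2 := he (show 2 * m + 1 < 2 * n + 1 by omega)
    dsimp only
    omega
  have hblock : ∀ x ∈ FS.map (Set.range fun n => e (2 * n) + e (2 * n + 1)), ∃ t : Finset ℕ,
      t.Nonempty ∧ ∑ i ∈ t, e i = x ∧ ∀ i, 2 * i ∈ t ↔ 2 * i + 1 ∈ t := by
    intro x hx
    obtain ⟨s, hs, rfl⟩ := exists_index_of_mem_FS hd hx
    refine ⟨s.image (2 * ·) ∪ s.image (2 * · + 1), (hs.image _).inl, ?_, fun i => ?_⟩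
    · rw [Finset.sum_union, Finset.sum_image, Finset.sum_image, Finset.sum_add_distrib]
      · intro i _ j _ hij
        simpa using hij
      · intro i _ j _ hij
        simpa using hij
      · rw [Finset.disjoint_left]
        intro i hi hi'
        simp only [Finset.mem_image] at hi hi'
        omega
    · simp only [Finset.mem_union, Finset.mem_image]
      constructor
      · rintro (⟨j, hj, h⟩ | ⟨j, hj, h⟩)
        · exact Or.inr ⟨j, hj, by omega⟩
        · omega
      · rintro (⟨j, hj, h⟩ | ⟨j, hj, h⟩)
        · omega
        · exact Or.inl ⟨j, hj, by omega⟩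
  refine ⟨_, Set.infinite_range_of_injective hd.injective, fun x hx y hy => ?_⟩
  obtain ⟨s, hs, rfl, hs2⟩ := hblock x hx
  obtain ⟨t, ht, rfl, ht2⟩ := hblock y hy
  obtain ⟨m, hm⟩ : ∃ m, s.min' hs = 2 * m := by
    rcases Nat.even_or_odd' (s.min' hs) with ⟨m, hm | hm⟩
    · exact ⟨m, hm⟩
    · have := s.min'_le _ ((hs2 m).2 (hm ▸ s.min'_mem hs))
      omega
  obtain ⟨M, hM⟩ : ∃ M, t.max' ht = 2 * M + 1 := by
    rcases Nat.even_or_odd' (t.max' ht) with ⟨M, hM | hM⟩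
    · have := t.le_max' _ ((ht2 M).1 (hM ▸ t.max'_mem ht))
      omega
    · exact ⟨M, hM⟩
  have hMt : 2 * M + 1 ∈ t := hM ▸ t.max'_mem ht
  have hax : a (∑ i ∈ s, e i) = α (e (2 * m)) := by
    rcases (exists_min_of_stable hX (fun n => (hQ n).1) hs).2 with h | h
    · have h1 := (hs2 m).1 (hm ▸ s.min'_mem hs)
      rw [h, hm, Finset.mem_singleton] at h1
      omega
    · rw [h, hm]
  have hle : ∀ i ∈ t, i ≤ 2 * M + 1 := fun i hi => hM ▸ t.le_max' i hi
  rw [hax]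
  -- Whichever of the two indices comes later was chosen to make its value exceed the other.
  rcases lt_or_ge (2 * m) (2 * M + 1) with hlt | hge
  · have h1 := hX (2 * M + 1) {2 * m} (by simpa using hlt) (by simp)
    rw [Finset.sum_singleton] at h1
    have h2 := hX (2 * M + 1) (t.erase (2 * M + 1)) (fun i hi => Finset.mem_range.2
      (lt_of_le_of_ne (hle i (Finset.mem_of_mem_erase hi)) (Finset.ne_of_mem_erase hi)))
      ⟨2 * M, Finset.mem_erase.2 ⟨by omega, (ht2 M).2 hMt⟩⟩
    have := (hQ (2 * M + 1)).2.1 _ h2 _ h1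
    rw [Finset.sum_erase_add _ _ hMt] at this
    exact this.ne
  · refine ((hQ (2 * m)).2.2 _ (hX _ t (fun i hi => Finset.mem_range.2 ?_) ht)).ne'
    have := hle i hi
    omega

/-- If both coordinates depend only on the smallest index, or the lower one escapes to infinity with
the largest index, each lower value has finitely many upper partners. If the lower one is constant,
or stable while the upper one escapes, the two ranges are disjoint. -/
theorem not_ramsey_le_hindman : ¬ IdealLE ramsey hindman := by
  refine not_idealLE_of_forall fun φ => ?_
  obtain ⟨a, b, hab, hφ⟩ := exists_pair_coordinates φ
  obtain ⟨p, hp⟩ := exists_isFreeIdempotent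
  rcases hp.trichotomy a with ⟨c, hc⟩ | ⟨ha, ⟨α, hα, hst⟩ | hinf⟩
  · obtain ⟨d, X, hd, hG, hX, -, -⟩ := exists_strictMono_sums hp hc (fun _ _ _ => True)
      fun _ _ _ => Eventually.of_forall fun _ => trivial
    refine ⟨Set.range d, Set.infinite_range_of_injective hd.injective,
      ramsey_of_disjoint hab hφ fun x hx y hy => ?_⟩
    obtain ⟨s, hs, rfl⟩ := exists_index_of_mem_FS hd hx
    obtain ⟨t, ht, rfl⟩ := exists_index_of_mem_FS hd hy
    have h1 : a _ = c := mem_of_sums hG hX hs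
    have h2 : a _ = c := mem_of_sums hG hX ht
    have := hab (∑ i ∈ t, d i)
    omega
  · rcases hp.trichotomy b with ⟨c, hc⟩ | ⟨-, ⟨β, -, hst'⟩ | hinf⟩
    · obtain ⟨x, h1, h2⟩ := (hc.and (ha c)).exists
      have := hab x
      omega
    · obtain ⟨d, X, hd, hG, hX, -, hQ⟩ := exists_strictMono_sums hp (hst.and hst')
        (fun n X y => (∀ x ∈ X, a (x + y) = α x ∧ α (x + y) = α x) ∧
          (∀ x ∈ X, b (x + y) = β x ∧ β (x + y) = β x) ∧ n < a y ∧ n < α y)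
        fun n X h => ((eventually_all_finset X).2 fun x hx => (h x hx).1).and
          (((eventually_all_finset X).2 fun x hx => (h x hx).2).and ((ha _).and (hα _)))
      refine ⟨Set.range d, Set.infinite_range_of_injective hd.injective,
        ramsey_of_finite hab hφ fun c => ?_⟩
      refine ((Finset.range c).biUnion fun m => {b (d m), β (d m)}).finite_toSet.subset ?_
      rintro _ ⟨x, ⟨hx, hxc⟩, rfl⟩
      obtain ⟨s, hs, rfl⟩ := exists_index_of_mem_FS hd hx
      have h1 := (exists_min_of_stable hX (fun n => (hQ n).1) hs).2
      have h2 := (exists_min_of_stable hX (fun n => (hQ n).2.1) hs).2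
      generalize s.min' hs = m at h1 h2
      have hm := (hQ m).2.2
      refine Finset.mem_coe.2 (Finset.mem_biUnion.2 ⟨m, Finset.mem_range.2 ?_, ?_⟩)
      · rcases h1 with h | h
        · rw [h, Finset.sum_singleton] at hxc
          omega
        · omega
      · rcases h2 with h | h <;> simp [h]
    · obtain ⟨D, hD, h⟩ := exists_disjoint_coordinates hp hα hst hinf
      exact ⟨D, hD, ramsey_of_disjoint hab hφ h⟩
  · obtain ⟨d, X, hd, hG, hX, -, hQ⟩ := exists_strictMono_sums hp hinf
      (fun n X y => (∀ x ∈ X, n < a (x + y)) ∧ n < a y)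
      fun n X h => ((eventually_all_finset X).2 fun x hx => h x hx _).and (ha _)
    refine ⟨Set.range d, Set.infinite_range_of_injective hd.injective,
      ramsey_of_finite hab hφ fun c => Set.Finite.image _ ?_⟩
    refine ((Finset.range c).biUnion fun n =>
      insert (d n) ((X n).image fun x => x + d n)).finite_toSet.subset ?_
    rintro x ⟨hx, hxc⟩
    obtain ⟨s, hs, rfl⟩ := exists_index_of_mem_FS hd hx
    obtain ⟨n, hn⟩ := eq_or_eq_add_of_sums hX hs
    refine Finset.mem_coe.2 (Finset.mem_biUnion.2 ⟨n, Finset.mem_range.2 ?_, ?_⟩)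
    · rcases hn with h | ⟨x, hxn, h⟩
      · rw [← hxc, h]
        exact (hQ n).2
      · rw [← hxc, h]
        exact (hQ n).1 x hxn
    · rcases hn with h | ⟨x, hxn, h⟩
      · simp [h]
      · exact h ▸ Finset.mem_insert_of_mem (Finset.mem_image_of_mem (fun x => x + d n) hxn)

/-! ### The reductions of `Δ` -/

/-- Differences of partial sums of `D` are sums over blocks; dropping early partial sums drops the
blocks that meet `K`. -/
theorem exists_partialSums {D : Set ℕ} (hD : D.Infinite) : ∃ E : Set ℕ, E.Infinite ∧
    ∀ K : Set ℕ, K.Finite → ∃ L : Set ℕ, L.Finite ∧ Δ.map (E \ L) ⊆ FS.map (D \ K) := by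
  classical
  have := hD.to_subtype
  let d := Nat.orderEmbeddingOfSet D
  have hdD : ∀ i, d i ∈ D := fun i => by
    rw [← Nat.orderEmbeddingOfSet_range D]
    exact Set.mem_range_self i
  have hmono : Monotone fun n => ∑ i ∈ Finset.range n, d i := fun m n hmn =>
    Finset.sum_le_sum_of_subset (Finset.range_mono hmn)
  -- The shift is needed because the first element of `D` may be 0, making the first two partial
  -- sums equal.
  have hinf : StrictMono fun n => ∑ i ∈ Finset.range (n + 1), d i :=
    strictMono_nat_of_lt_succ fun n => by
      have : d 0 < d (n + 1) := d.strictMono (Nat.succ_pos n)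
      rw [Finset.sum_range_succ _ (n + 1)]
      omega
  refine ⟨Set.range fun n => ∑ i ∈ Finset.range n, d i,
    (Set.infinite_range_of_injective hinf.injective).mono ?_, fun K hK => ?_⟩
  · rintro _ ⟨n, rfl⟩
    exact ⟨n + 1, rfl⟩
  obtain ⟨N, hN⟩ : ∃ N, ∀ i, N ≤ i → d i ∉ K := by
    obtain ⟨N, hN⟩ := (hK.preimage d.injective.injOn).bddAbove
    exact ⟨N + 1, fun i hi hiK => by have := hN hiK; omega⟩
  refine ⟨(fun n => ∑ i ∈ Finset.range n, d i) '' Set.Iio N, (Set.finite_Iio N).image _, ?_⟩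
  rintro _ ⟨_, ⟨⟨n, rfl⟩, -⟩, _, ⟨⟨m, rfl⟩, hm⟩, hlt, rfl⟩
  have hmn : m < n := by
    by_contra h
    exact absurd (hmono (not_lt.1 h)) (not_le.2 hlt)
  have hNm : N ≤ m := by
    by_contra h
    exact hm ⟨m, not_le.1 h, rfl⟩
  refine ⟨(Finset.Ico m n).image d, (Finset.nonempty_Ico.2 hmn).image d, ?_, ?_⟩
  · intro x hx
    obtain ⟨i, hi, rfl⟩ := Finset.mem_image.1 (Finset.mem_coe.1 hx)
    exact ⟨hdD i, hN i (hNm.trans (Finset.mem_Ico.1 hi).1)⟩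
  · rw [Finset.sum_image d.injective.injOn]
    exact Nat.sub_eq_of_eq_add' (Finset.sum_range_add_sum_Ico _ hmn.le).symm

theorem delta_le_FS : SetOp.LE Δ FS := by
  refine ⟨id, fun D hD => ?_⟩
  obtain ⟨E, hE, h⟩ := exists_partialSums hD
  exact ⟨E, hE, fun K hK => by simpa using h K hK⟩

theorem diff_subset_hindman : diff ⊆ hindman := by
  intro A hA D hD hsub
  obtain ⟨E, hE, h⟩ := exists_partialSums hD
  obtain ⟨L, hL, h⟩ := h ∅ Set.finite_empty
  rw [Set.sdiff_empty] at h
  exact hA (E \ L) (hE.sdiff hL) (h.trans hsub)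

theorem delta_le_r : SetOp.LE Δ r := by
  -- The map is maximum minus minimum, the minimum being the sum minus the maximum.
  refine ⟨fun s => s.1.sup id - (s.1.sum id - s.1.sup id),
    fun H hH => ⟨H, hH, fun K hK => ⟨K, hK, ?_⟩⟩⟩
  rintro _ ⟨a, ha, b, hb, hba, rfl⟩
  refine ⟨⟨{a, b}, Finset.card_pair hba.ne'⟩, ?_, ?_⟩
  · simp only [r, Set.mem_ofPred_eq, Finset.coe_pair]
    exact Set.insert_subset ha (Set.singleton_subset_iff.2 hb)
  · simp only [Finset.sup_insert, Finset.sup_singleton, id, Finset.sum_pair hba.ne']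
    rw [sup_eq_left.2 hba.le, Nat.add_sub_cancel_left]

/-! ### Transfer of non-reducibility from ideals to functions -/

theorem not_le_of_not_idealLE {Ω Ω' Λ Λ' : Type*} {ρ₂ : SetOp Ω Λ} {ρ₁ : SetOp Ω' Λ'}
    {I₂ : Set (Set Λ)} {I₁ : Set (Set Λ')} (h₂ : ρ₂.ideal = I₂) (h₁ : ρ₁.ideal = I₁)
    (hdom : ∀ F ∈ ρ₂.dom, ∀ K : Set Ω, K.Finite → F \ K ∈ ρ₂.dom) (h : ¬ IdealLE I₂ I₁) :
    ¬ IdealLE I₂ I₁ ∧ ¬ SetOp.LE ρ₂ ρ₁ := by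
  subst h₂ h₁
  exact ⟨h, fun hle => h (hle.idealLE hdom)⟩

theorem ideal_ofIdeal_summable : (SetOp.ofIdeal summable).ideal = summable :=
  ideal_ofIdeal fun _ _ => summable_mono

theorem ideal_ofIdeal_vdW : (SetOp.ofIdeal vdW).ideal = vdW :=
  ideal_ofIdeal fun _ _ => vdW_mono

end Katetov

theorem mainTheorem9 :
    (¬ Katetov.IdealLE Katetov.hindman Katetov.ramsey ∧
      ¬ Katetov.SetOp.LE Katetov.FS Katetov.r) ∧
    (¬ Katetov.IdealLE Katetov.ramsey Katetov.hindman ∧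
      ¬ Katetov.SetOp.LE Katetov.r Katetov.FS) ∧
    (Katetov.SetOp.LE Katetov.Δ Katetov.FS ∧
      Katetov.diff ⊆ Katetov.hindman ∧
      Katetov.IdealLE Katetov.diff Katetov.hindman) ∧
    (Katetov.SetOp.LE Katetov.Δ Katetov.r ∧
      Katetov.IdealLE Katetov.diff Katetov.ramsey) ∧
    (¬ Katetov.IdealLE Katetov.ramsey Katetov.diff ∧
      ¬ Katetov.SetOp.LE Katetov.r Katetov.Δ) ∧
    (¬ Katetov.IdealLE Katetov.hindman Katetov.diff ∧
      ¬ Katetov.SetOp.LE Katetov.FS Katetov.Δ) ∧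
    (¬ Katetov.IdealLE Katetov.summable Katetov.ramsey ∧
      ¬ Katetov.SetOp.LE (Katetov.SetOp.ofIdeal Katetov.summable) Katetov.r) ∧
    (¬ Katetov.IdealLE Katetov.summable Katetov.hindman ∧
      ¬ Katetov.SetOp.LE (Katetov.SetOp.ofIdeal Katetov.summable) Katetov.FS) ∧
    (¬ Katetov.IdealLE Katetov.summable Katetov.diff ∧
      ¬ Katetov.SetOp.LE (Katetov.SetOp.ofIdeal Katetov.summable) Katetov.Δ) ∧
    (¬ Katetov.IdealLE Katetov.summable Katetov.vdW ∧
      ¬ Katetov.SetOp.LE (Katetov.SetOp.ofIdeal Katetov.summable)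
        (Katetov.SetOp.ofIdeal Katetov.vdW)) ∧
    (¬ Katetov.IdealLE Katetov.diff Katetov.summable ∧
      ¬ Katetov.SetOp.LE Katetov.Δ (Katetov.SetOp.ofIdeal Katetov.summable)) ∧
    (¬ Katetov.IdealLE Katetov.hindman Katetov.summable ∧
      ¬ Katetov.SetOp.LE Katetov.FS (Katetov.SetOp.ofIdeal Katetov.summable)) ∧
    (¬ Katetov.IdealLE Katetov.ramsey Katetov.summable ∧
      ¬ Katetov.SetOp.LE Katetov.r (Katetov.SetOp.ofIdeal Katetov.summable)) ∧
    (¬ Katetov.IdealLE Katetov.diff Katetov.vdW ∧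
      ¬ Katetov.SetOp.LE Katetov.Δ (Katetov.SetOp.ofIdeal Katetov.vdW)) ∧
    (¬ Katetov.IdealLE Katetov.hindman Katetov.vdW ∧
      ¬ Katetov.SetOp.LE Katetov.FS (Katetov.SetOp.ofIdeal Katetov.vdW)) ∧
    (¬ Katetov.IdealLE Katetov.ramsey Katetov.vdW ∧
      ¬ Katetov.SetOp.LE Katetov.r (Katetov.SetOp.ofIdeal Katetov.vdW)) := by
  have hFS : ∀ F ∈ Katetov.FS.dom, ∀ K : Set ℕ, K.Finite → F \ K ∈ Katetov.FS.dom :=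
    fun _ hF _ hK => Set.Infinite.sdiff hF hK
  have hr : ∀ F ∈ Katetov.r.dom, ∀ K : Set ℕ, K.Finite → F \ K ∈ Katetov.r.dom :=
    fun _ hF _ hK => Set.Infinite.sdiff hF hK
  have hΔ : ∀ F ∈ Katetov.Δ.dom, ∀ K : Set ℕ, K.Finite → F \ K ∈ Katetov.Δ.dom :=
    fun _ hF _ hK => Set.Infinite.sdiff hF hK
  have hS : ∀ F ∈ (Katetov.SetOp.ofIdeal Katetov.summable).dom, ∀ K : Set ℕ, K.Finite →
      F \ K ∈ (Katetov.SetOp.ofIdeal Katetov.summable).dom :=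
    fun _ hF _ hK => Katetov.not_summable_diff hF hK
  have hDH : Katetov.IdealLE Katetov.diff Katetov.hindman := Katetov.delta_le_FS.idealLE hΔ
  have hDR : Katetov.IdealLE Katetov.diff Katetov.ramsey := Katetov.delta_le_r.idealLE hΔ
  have eS := Katetov.ideal_ofIdeal_summable
  have eW := Katetov.ideal_ofIdeal_vdW
  exact ⟨Katetov.not_le_of_not_idealLE rfl rfl hFS Katetov.not_hindman_le_ramsey,
    Katetov.not_le_of_not_idealLE rfl rfl hr Katetov.not_ramsey_le_hindman,
    ⟨Katetov.delta_le_FS, Katetov.diff_subset_hindman, hDH⟩,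
    ⟨Katetov.delta_le_r, hDR⟩,
    Katetov.not_le_of_not_idealLE rfl rfl hr fun h => Katetov.not_ramsey_le_hindman (h.trans hDH),
    Katetov.not_le_of_not_idealLE rfl rfl hFS fun h => Katetov.not_hindman_le_ramsey (h.trans hDR),
    Katetov.not_le_of_not_idealLE eS rfl hS Katetov.not_summable_le_ramsey,
    Katetov.not_le_of_not_idealLE eS rfl hS Katetov.not_summable_le_hindman,
    Katetov.not_le_of_not_idealLE eS rfl hS
      fun h => Katetov.not_summable_le_hindman (h.trans hDH),
    Katetov.not_le_of_not_idealLE eS eW hS Katetov.not_summable_le_vdW,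
    Katetov.not_le_of_not_idealLE rfl eS hΔ Katetov.not_diff_le_summable,
    Katetov.not_le_of_not_idealLE rfl eS hFS
      fun h => Katetov.not_diff_le_summable (hDH.trans h),
    Katetov.not_le_of_not_idealLE rfl eS hr
      fun h => Katetov.not_diff_le_summable (hDR.trans h),
    Katetov.not_le_of_not_idealLE rfl eW hΔ Katetov.not_diff_le_vdW,
    Katetov.not_le_of_not_idealLE rfl eW hFS fun h => Katetov.not_diff_le_vdW (hDH.trans h),
    Katetov.not_le_of_not_idealLE rfl eW hr fun h => Katetov.not_diff_le_vdW (hDR.trans h)⟩
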